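/- Let $B^2(1)=\{x\in\mathbb R^2:|x|<1\}$ carry Berwald's Finsler metric $$F_B(x,y)=\frac{\left(\sqrt{|y|^2-|x|^2|y|^2+\langle x,y\rangle^2}+\langle x,y\rangle\right)^2}{(1-|x|^2)^2\sqrt{|y|^2-|x|^2|y|^2+\langle x,y\rangle^2}},\qquad y\neq 0,$$ with fundamental tensor $g_{ij}(x,y)=\tfrac12\,\partial^2 (F_B^2)/\partial y_i\partial y_j$. The Holmes–Thompson area of a region $\Omega\subseteq B^2(1)$ is $$A_{HT}(\Omega)=\int_\Omega\sigma_{HT}(x)\,dx,\qquad \sigma_{HT}(x)=\frac1\pi\int_{F_B(x,y)<1}\det(g_{ij}(x,y))\,dy .$$ Let $c(t)=(x_1(t),x_2(t))$, $t\in[t_0,t_1]$, $t_0<t_1$, be a continuous, piecewise $C^1$ simple closed curve in $B^2(1)$ (so $c(t_0)=c(t_1)$ and $c$ is injective on $[t_0,t_1)$), and let $\Omega$ be the domain it encloses, that is, the bounded part of $\mathbb R^2\setminus c([t_0,t_1])$. Suppose that $c$ is positively oriented, that is, it has winding number $1$ about the points of $\Omega$. Then $\Omega\subseteq B^2(1)$,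 the integral defining $A_{HT}(\Omega)$ and the line integral below converge absolutely, and $$A_{HT}(\Omega)=\frac18\int_{t_0}^{t_1}\frac{x_1^2+x_2^2-4}{(1-x_1^2-x_2^2)^{5/2}}\,\bigl(x_2\dot x_1-x_1\dot x_2\bigr)\,dt .$$ -/

import Mathlib

open MeasureTheory Set

/-- The fundamental tensor `g_ij(x, y) = (1/2) ∂²(F²)/∂y_i∂y_j` of a (Finsler) function `F(x, y)` on
`ℝⁿ × ℝⁿ`, as an iterated partial derivative in the standard coordinates. -/
noncomputable def fundamentalTensor {n : ℕ}
    (F : EuclideanSpace ℝ (Fin n) → EuclideanSpace ℝ (Fin n) → ℝ)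
    (x y : EuclideanSpace ℝ (Fin n)) : Matrix (Fin n) (Fin n) ℝ :=
  Matrix.of fun i j =>
    (1 / 2) * lineDeriv ℝ
      (fun v => lineDeriv ℝ (fun w => F x w ^ 2) v (EuclideanSpace.single j 1))
      y (EuclideanSpace.single i 1)

/-- The Holmes–Thompson volume element
`σ(x) = (1 / Vol(Bⁿ)) ∫_{F(x, y) < 1} det (g_ij(x, y)) dy`. -/
noncomputable def holmesThompsonDensity {n : ℕ}
    (F : EuclideanSpace ℝ (Fin n) → EuclideanSpace ℝ (Fin n) → ℝ)
    (x : EuclideanSpace ℝ (Fin n)) : ℝ :=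
  (volume.real (Metric.ball (0 : EuclideanSpace ℝ (Fin n)) 1))⁻¹ *
    ∫ y in {y | F x y < 1}, (fundamentalTensor F x y).det

/-- The Holmes–Thompson volume (area, if `n = 2`) of `Ω`: the integral over `Ω` of the
Holmes–Thompson volume element. -/
noncomputable def holmesThompsonVolume {n : ℕ}
    (F : EuclideanSpace ℝ (Fin n) → EuclideanSpace ℝ (Fin n) → ℝ)
    (Ω : Set (EuclideanSpace ℝ (Fin n))) : ℝ :=
  ∫ x in Ω, holmesThompsonDensity F x

/-- Berwald's metric, a Finsler metric on the unit ball `|x| < 1` of constant flag curvature `0`. -/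
noncomputable def berwaldMetric {n : ℕ} (x y : EuclideanSpace ℝ (Fin n)) : ℝ :=
  (√(‖y‖ ^ 2 - (‖x‖ ^ 2 * ‖y‖ ^ 2 - inner ℝ x y ^ 2)) + inner ℝ x y) ^ 2 /
    ((1 - ‖x‖ ^ 2) ^ 2 * √(‖y‖ ^ 2 - (‖x‖ ^ 2 * ‖y‖ ^ 2 - inner ℝ x y ^ 2)))

/-- `c` is a continuous piecewise `C¹` curve on `[a, b]`: there is a finite subdivision
`a = p 0 ≤ p 1 ≤ ⋯ ≤ p m = b` such that `c` is `C¹` on each closed piece (one-sidedly at its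
ends). -/
def IsPiecewiseC1 (c : ℝ → EuclideanSpace ℝ (Fin 2)) (a b : ℝ) : Prop :=
  ContinuousOn c (Icc a b) ∧
    ∃ (m : ℕ) (p : ℕ → ℝ), Monotone p ∧ p 0 = a ∧ p m = b ∧
      ∀ i < m, ContDiffOn ℝ 1 c (Icc (p i) (p (i + 1)))

/-- `c` restricted to `[a, b]` is a piecewise `C¹` simple closed curve. -/
structure IsSimpleClosedCurve (c : ℝ → EuclideanSpace ℝ (Fin 2)) (a b : ℝ) : Prop where
  lt : a < b
  piecewiseC1 : IsPiecewiseC1 c a b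
  closed : c a = c b
  simple : InjOn c (Ico a b)

/-- The region enclosed by the curve `c` on `[a, b]`: the bounded part of the complement of its
trace, that is, the points off the trace whose connected component in the complement is bounded.
(For a simple closed curve this is the one bounded component of the complement.) -/
def enclosedRegion (c : ℝ → EuclideanSpace ℝ (Fin 2)) (a b : ℝ) :
    Set (EuclideanSpace ℝ (Fin 2)) :=
  {q | q ∉ c '' Icc a b ∧ Bornology.IsBounded (connectedComponentIn (c '' Icc a b)ᶜ q)}

/-- The winding number of the closed piecewise `C¹` curve `c` on `[a, b]` about a point `q` off the
curve: `(1 / 2π) ∮ ((x₁ - q₁) dx₂ - (x₂ - q₂) dx₁) / |x - q|²`. -/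
noncomputable def curveWindingNumber (c : ℝ → EuclideanSpace ℝ (Fin 2)) (a b : ℝ)
    (q : EuclideanSpace ℝ (Fin 2)) : ℝ :=
  (1 / (2 * Real.pi)) * ∫ t in a..b,
    ((c t 0 - q 0) * deriv (fun s => c s 1) t - (c t 1 - q 1) * deriv (fun s => c s 0) t) /
      ‖c t - q‖ ^ 2

/-- A simple closed curve is positively oriented (runs counterclockwise) if it has winding
number `1` about the points that it encloses. -/
def IsPositivelyOriented (c : ℝ → EuclideanSpace ℝ (Fin 2)) (a b : ℝ) : Prop :=
  ∀ q ∈ enclosedRegion c a b, curveWindingNumber c a b q = 1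

/-!
The proof has two independent halves.

*The area element.* At `x`, put `u = |x|²` and `B(v, w) = (1 - u)⟨v, w⟩ + ⟨x, v⟩⟨x, w⟩`, a positive
form of determinant `1 - u`. Berwald's metric is `F = (α + β)² / ((1 - u)² α)` with
`α² = B(y, y)` and `β = ⟨x, y⟩`, so its fundamental tensor is a combination of `B`, `dα` and `dβ`
with coefficients depending on `s = β / α` only, and
`det g = (1 + s)⁶ (1 + 2u - 3s²) / (1 - u)⁷`
(`det_fundamentalTensor_berwaldMetric`). In a frame orthonormal for `B` with first axis along `x`
(`exists_kleinFrame`) one has `s = |x| cos θ` in polar coordinates, and the integral over the unit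
disc of `F` is that of a trigonometric polynomial. The area element is
`(1 + u - u² / 8) (1 - u)^(-7/2)` (`holmesThompsonDensity_berwaldMetric`), a radial function `g(|x|)`.

*Green's theorem.* For a radial density `g` Green's theorem follows from winding numbers. Off the
curve, the winding number is locally constant and vanishes far away, so with the assumed orientation
it is the indicator function of the enclosed region; and the curve is a null set
(`IsPiecewiseC1.volume_image_eq_zero`). The enclosed mass is therefore
`(2π)⁻¹ Im ∫ g(|q|) ∮ dz / (z - q) dq`. By Fubini's theorem the inner integral can be taken over
`q` first, and the shell theorem `integral_ball_radial_mul_inv_sub`, a consequence of the mean value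
property, evaluates it as `(2π / z) ∫₀^|z| r g(r) dr`. For the area element above this last integral
is elementary (`integral_mul_berwaldRadialDensity`), which gives the line integral of the theorem.
No part of the Jordan curve theorem is needed.
-/

/-! ### The fundamental tensor of Berwald's metric -/

/-- The bilinear form `B_x(v, w) = (1 - |x|²)⟨v, w⟩ + ⟨x, v⟩⟨x, w⟩`. Up to the factor
`(1 - |x|²)²` it is the Klein model of the hyperbolic metric at `x`, and Berwald's metric is
`(α + β)² / ((1 - |x|²)² α)` with `α² = B_x(y, y)` and `β = ⟨x, y⟩`. -/
noncomputable def kleinForm {n : ℕ} (x v w : EuclideanSpace ℝ (Fin n)) : ℝ :=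
  (1 - ‖x‖ ^ 2) * inner ℝ v w + inner ℝ x v * inner ℝ x w

/-- The norm `α = √(B_x(y, y))` of `y` with respect to `kleinForm x`. -/
noncomputable def kleinNorm {n : ℕ} (x y : EuclideanSpace ℝ (Fin n)) : ℝ :=
  √(kleinForm x y y)

section Tensor

variable {n : ℕ} {x y : EuclideanSpace ℝ (Fin n)}

lemma berwaldMetric_eq (x y : EuclideanSpace ℝ (Fin n)) :
    berwaldMetric x y =
      (kleinNorm x y + inner ℝ x y) ^ 2 / ((1 - ‖x‖ ^ 2) ^ 2 * kleinNorm x y) := by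
  have : ‖y‖ ^ 2 - (‖x‖ ^ 2 * ‖y‖ ^ 2 - inner ℝ x y ^ 2) = kleinForm x y y := by
    rw [kleinForm, real_inner_self_eq_norm_sq]; ring
  rw [berwaldMetric, this, kleinNorm]

lemma one_sub_norm_sq_pos (hx : ‖x‖ < 1) : 0 < 1 - ‖x‖ ^ 2 := by
  nlinarith [norm_nonneg x]

lemma kleinForm_self_pos (hx : ‖x‖ < 1) (hy : y ≠ 0) : 0 < kleinForm x y y := by
  rw [kleinForm, real_inner_self_eq_norm_sq]
  have := mul_pos (one_sub_norm_sq_pos hx) (pow_pos (norm_pos_iff.2 hy) 2)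
  nlinarith [mul_self_nonneg (inner ℝ x y)]

lemma kleinNorm_pos (hx : ‖x‖ < 1) (hy : y ≠ 0) : 0 < kleinNorm x y :=
  Real.sqrt_pos.2 (kleinForm_self_pos hx hy)

lemma kleinNorm_sq (hx : ‖x‖ < 1) (y : EuclideanSpace ℝ (Fin n)) :
    kleinNorm x y ^ 2 = kleinForm x y y := by
  rcases eq_or_ne y 0 with rfl | hy
  · simp [kleinNorm, kleinForm]
  · exact Real.sq_sqrt (kleinForm_self_pos hx hy).le

lemma hasDerivAt_inner_line (x y v : EuclideanSpace ℝ (Fin n)) :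
    HasDerivAt (fun t : ℝ => inner ℝ x (y + t • v)) (inner ℝ x v) 0 := by
  simp only [inner_add_right, inner_smul_right]
  simpa using ((hasDerivAt_id (0 : ℝ)).mul_const (inner ℝ x v)).const_add (inner ℝ x y)

lemma hasDerivAt_kleinForm_line (x y v w : EuclideanSpace ℝ (Fin n)) :
    HasDerivAt (fun t : ℝ => kleinForm x (y + t • v) w) (kleinForm x v w) 0 := by
  have h : (fun t : ℝ => kleinForm x (y + t • v) w) =
      fun t => kleinForm x y w + t * kleinForm x v w := by
    funext t; simp only [kleinForm, inner_add_left, inner_add_right, inner_smul_left,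
      inner_smul_right]; simp; ring
  rw [h]
  simpa using ((hasDerivAt_id (0 : ℝ)).mul_const (kleinForm x v w)).const_add (kleinForm x y w)

lemma hasDerivAt_kleinNorm_line (hx : ‖x‖ < 1) (hy : y ≠ 0) (v : EuclideanSpace ℝ (Fin n)) :
    HasDerivAt (fun t : ℝ => kleinNorm x (y + t • v)) (kleinForm x y v / kleinNorm x y) 0 := by
  have h : (fun t : ℝ => kleinForm x (y + t • v) (y + t • v)) =
      fun t => kleinForm x y y + t * (2 * kleinForm x y v) + t ^ 2 * kleinForm x v v := by
    funext t; simp only [kleinForm, inner_add_left, inner_add_right, inner_smul_left,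
      inner_smul_right, real_inner_comm v y]; simp; ring
  have h1 : HasDerivAt (fun t : ℝ => kleinForm x (y + t • v) (y + t • v))
      (2 * kleinForm x y v) 0 := by
    rw [h]
    have h2 := (((hasDerivAt_id (0 : ℝ)).mul_const (2 * kleinForm x y v)).const_add
      (kleinForm x y y)).add (((hasDerivAt_id (0 : ℝ)).pow 2).mul_const (kleinForm x v v))
    refine h2.congr_deriv ?_
    simp
  have hp := kleinForm_self_pos hx hy
  have h3 := h1.sqrt (by simpa using hp.ne')
  refine h3.congr_deriv ?_
  have := Real.sqrt_pos.2 hp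
  simp only [zero_smul, add_zero, kleinNorm]
  field_simp

/-- The first derivative of `F²` for Berwald's metric `F`, in the direction `w`. -/
lemma lineDeriv_berwaldMetric_sq (hx : ‖x‖ < 1) (hy : y ≠ 0) (w : EuclideanSpace ℝ (Fin n)) :
    lineDeriv ℝ (fun w => berwaldMetric x w ^ 2) y w =
      (4 * (kleinNorm x y + inner ℝ x y) ^ 3 * inner ℝ x w * kleinNorm x y ^ 2 +
        2 * (kleinNorm x y + inner ℝ x y) ^ 3 * (kleinNorm x y - inner ℝ x y) *
          kleinForm x y w) / ((1 - ‖x‖ ^ 2) ^ 4 * kleinNorm x y ^ 4) := by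
  have hA := kleinNorm_pos hx hy
  have hu := one_sub_norm_sq_pos hx
  have e : (fun w => berwaldMetric x w ^ 2) = fun w =>
      ((kleinNorm x w + inner ℝ x w) ^ 2 / ((1 - ‖x‖ ^ 2) ^ 2 * kleinNorm x w)) ^ 2 := by
    funext w; rw [berwaldMetric_eq]
  rw [e, lineDeriv]
  have h1 := hasDerivAt_kleinNorm_line hx hy w
  have h2 := hasDerivAt_inner_line x y w
  have h3 := (((h1.add h2).pow 2).div (h1.const_mul ((1 - ‖x‖ ^ 2) ^ 2))
    (by simp [hu.ne', hA.ne'])).pow 2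
  refine h3.deriv.trans ?_
  simp only [zero_smul, add_zero, Pi.add_apply, Pi.pow_apply, Pi.div_apply,
    show 2 - 1 = 1 from rfl, pow_one]
  generalize 1 - ‖x‖ ^ 2 = d at *
  field_simp
  ring

/-- The fundamental tensor of Berwald's metric, with `s = ⟨x, y⟩ / α`, as a combination of
`B_x(v, w)`, of `⟨x, ·⟩` and of the differential `B_x(y, ·) / α` of `α`. -/
lemma lineDeriv_lineDeriv_berwaldMetric_sq (hx : ‖x‖ < 1) (hy : y ≠ 0)
    (v w : EuclideanSpace ℝ (Fin n)) {s : ℝ} (hs : s = inner ℝ x y / kleinNorm x y) :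
    (1 / 2) * lineDeriv ℝ (fun z => lineDeriv ℝ (fun w => berwaldMetric x w ^ 2) z w) y v =
      ((1 + s) ^ 2 * (4 * s ^ 2 - 2 * s) *
          ((kleinForm x y v / kleinNorm x y) * (kleinForm x y w / kleinNorm x y)) +
        (1 + s) ^ 2 * (2 - 4 * s) * ((kleinForm x y v / kleinNorm x y) * inner ℝ x w +
          inner ℝ x v * (kleinForm x y w / kleinNorm x y)) +
        6 * (1 + s) ^ 2 * (inner ℝ x v * inner ℝ x w) +
        (1 + s) ^ 3 * (1 - s) * kleinForm x v w) / (1 - ‖x‖ ^ 2) ^ 4 := by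
  have hA := kleinNorm_pos hx hy
  have hu := one_sub_norm_sq_pos hx
  have e : (fun z => lineDeriv ℝ (fun w => berwaldMetric x w ^ 2) z w) =ᶠ[nhds y] fun z =>
      (4 * (kleinNorm x z + inner ℝ x z) ^ 3 * inner ℝ x w * kleinNorm x z ^ 2 +
        2 * (kleinNorm x z + inner ℝ x z) ^ 3 * (kleinNorm x z - inner ℝ x z) *
          kleinForm x z w) / ((1 - ‖x‖ ^ 2) ^ 4 * kleinNorm x z ^ 4) := by
    filter_upwards [isOpen_ne.mem_nhds hy] with z hz using lineDeriv_berwaldMetric_sq hx hz w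
  rw [e.lineDeriv_eq, lineDeriv]
  have h1 := hasDerivAt_kleinNorm_line hx hy v
  have h2 := hasDerivAt_inner_line x y v
  have h4 := hasDerivAt_kleinForm_line x y v w
  have h3 := (((((h1.add h2).pow 3).const_mul 4).mul_const (inner ℝ x w)).mul (h1.pow 2) |>.add
    (((((h1.add h2).pow 3).const_mul 2).mul (h1.sub h2)).mul h4)).div
    ((h1.pow 4).const_mul ((1 - ‖x‖ ^ 2) ^ 4))
    (by simp [hu.ne', hA.ne'])
  have h5 := h3.deriv
  simp only [zero_smul, add_zero, Pi.add_apply, Pi.pow_apply, Pi.mul_apply, Pi.sub_apply] at h5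
  refine (congrArg (1 / 2 * ·) h5).trans ?_
  subst hs
  field_simp
  ring

end Tensor

/-- The determinant of the fundamental tensor of Berwald's metric in dimension two. -/
lemma det_fundamentalTensor_berwaldMetric {x y : EuclideanSpace ℝ (Fin 2)} (hx : ‖x‖ < 1)
    (hy : y ≠ 0) {s : ℝ} (hs : s = inner ℝ x y / kleinNorm x y) :
    (fundamentalTensor berwaldMetric x y).det =
      (1 + s) ^ 6 * (1 + 2 * ‖x‖ ^ 2 - 3 * s ^ 2) / (1 - ‖x‖ ^ 2) ^ 7 := by
  have hA := kleinNorm_pos hx hy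
  have hu := one_sub_norm_sq_pos hx
  have hA2 := kleinNorm_sq hx y
  have hn : ‖x‖ ^ 2 = x 0 ^ 2 + x 1 ^ 2 := by
    simp [EuclideanSpace.norm_sq_eq, Fin.sum_univ_two]
  have hi : inner ℝ x y = x 0 * y 0 + x 1 * y 1 := by
    simp [PiLp.inner_apply, Fin.sum_univ_two]; ring
  have hyy : inner ℝ y y = y 0 ^ 2 + y 1 ^ 2 := by
    simp [EuclideanSpace.norm_sq_eq, Fin.sum_univ_two]
  rw [Matrix.det_fin_two]
  simp only [fundamentalTensor, Matrix.of_apply]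
  simp only [lineDeriv_lineDeriv_berwaldMetric_sq hx hy _ _ hs]
  have hb0 : kleinForm x y (EuclideanSpace.single 0 1) =
      (1 - ‖x‖ ^ 2) * y 0 + inner ℝ x y * x 0 := by
    simp [kleinForm, EuclideanSpace.inner_single_right]
  have hb1 : kleinForm x y (EuclideanSpace.single 1 1) =
      (1 - ‖x‖ ^ 2) * y 1 + inner ℝ x y * x 1 := by
    simp [kleinForm, EuclideanSpace.inner_single_right]
  have h00 : kleinForm x (EuclideanSpace.single 0 1) (EuclideanSpace.single 0 1) =
      (1 - ‖x‖ ^ 2) + x 0 ^ 2 := by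
    simp [kleinForm, EuclideanSpace.inner_single_right]; ring
  have h11 : kleinForm x (EuclideanSpace.single 1 1) (EuclideanSpace.single 1 1) =
      (1 - ‖x‖ ^ 2) + x 1 ^ 2 := by
    simp [kleinForm, EuclideanSpace.inner_single_right]; ring
  have h01 : kleinForm x (EuclideanSpace.single 0 1) (EuclideanSpace.single 1 1) =
      x 0 * x 1 := by
    simp [kleinForm, EuclideanSpace.inner_single_right]
  have h10 : kleinForm x (EuclideanSpace.single 1 1) (EuclideanSpace.single 0 1) =
      x 0 * x 1 := by
    simp [kleinForm, EuclideanSpace.inner_single_right]; ring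
  have hx0 : inner ℝ x (EuclideanSpace.single 0 (1 : ℝ)) = x 0 := by
    simp [EuclideanSpace.inner_single_right]
  have hx1 : inner ℝ x (EuclideanSpace.single 1 (1 : ℝ)) = x 1 := by
    simp [EuclideanSpace.inner_single_right]
  rw [kleinForm, hyy, hi] at hA2
  rw [hx0, hx1, h00, h01, h10, h11]
  set Y0 := kleinForm x y (EuclideanSpace.single 0 1) / kleinNorm x y with hY0
  set Y1 := kleinForm x y (EuclideanSpace.single 1 1) / kleinNorm x y with hY1
  rw [hb0, hi] at hY0
  rw [hb1, hi] at hY1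
  rw [hi] at hs
  simp only [hn] at hA2 hu hY0 hY1 ⊢
  set A := kleinNorm x y
  generalize x 0 = a at *
  generalize x 1 = b at *
  generalize y 0 = p at *
  generalize y 1 = q at *
  -- `d` is the determinant of `B_x`. The adjugate of `B_x` takes the values `d`, `d s` and
  -- `d (1 - d)` on the pairs of covectors `(Y, Y)`, `(⟨x, ·⟩, Y)` and `(⟨x, ·⟩, ⟨x, ·⟩)`; these and
  -- the wedge product `a Y₁ - b Y₀` turn the determinant into a polynomial in `s` and `d`.
  set d := 1 - (a ^ 2 + b ^ 2) with hd
  have e1 : (d + a ^ 2) * Y1 ^ 2 + (d + b ^ 2) * Y0 ^ 2 - 2 * (a * b) * (Y0 * Y1) = d := by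
    rw [hY0, hY1]
    field_simp
    linear_combination (-d) * hA2
  have e2 : (d + a ^ 2) * (b * Y1) + (d + b ^ 2) * (a * Y0) - (a * b) * (Y0 * b + Y1 * a) =
      d * s := by
    rw [hY0, hY1, hs]
    field_simp
    ring
  have e3 : (a * Y1 - b * Y0) ^ 2 = d * (1 - d - s ^ 2) := by
    rw [hY0, hY1, hs]
    field_simp
    linear_combination (-d * (1 - d)) * hA2
  clear_value Y0 Y1 d A
  have hab : a ^ 2 + b ^ 2 = 1 - d := by rw [hd]; ring
  have hd0 : (d + a ^ 2) * (d + b ^ 2) - (a * b) ^ 2 = d := by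
    linear_combination d * hab
  have e4 : (d + a ^ 2) * b ^ 2 + (d + b ^ 2) * a ^ 2 - 2 * (a * b) * (a * b) = d * (1 - d) := by
    linear_combination d * hab
  rw [hab]
  have key : ∀ P m r c : ℝ, (m * (Y0 * Y0) + r * (Y0 * a + a * Y0) + c * (a * a) + P * (d + a ^ 2)) *
      (m * (Y1 * Y1) + r * (Y1 * b + b * Y1) + c * (b * b) + P * (d + b ^ 2)) -
      (m * (Y0 * Y1) + r * (Y0 * b + a * Y1) + c * (a * b) + P * (a * b)) *
      (m * (Y1 * Y0) + r * (Y1 * a + b * Y0) + c * (b * a) + P * (a * b)) =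
      P ^ 2 * d + P * (m * d + 2 * r * (d * s) + c * (d * (1 - d))) +
        (m * c - r ^ 2) * (d * (1 - d - s ^ 2)) := by
    intro P m r c
    linear_combination P ^ 2 * hd0 + P * m * e1 + 2 * P * r * e2 + P * c * e4 +
      (m * c - r ^ 2) * e3
  have hd4 : d ^ 4 ≠ 0 := by positivity
  have hd7 : d ^ 7 ≠ 0 := by positivity
  rw [div_mul_div_comm, div_mul_div_comm, ← sub_div, key, div_eq_div_iff (mul_ne_zero hd4 hd4) hd7]
  ring

/-! ### The Holmes–Thompson area element -/

lemma integral_polar_rays {F : Type*} [NormedAddCommGroup F] [NormedSpace ℝ F] [CompleteSpace F]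
    (f : ℂ → F) (hf : IntegrableOn (fun p : ℝ × ℝ => p.1 • f (Complex.polarCoord.symm p))
      (Ioi 0 ×ˢ Ioo (-Real.pi) Real.pi)) :
    ∫ z, f z = ∫ θ in Ioo (-Real.pi) Real.pi, ∫ r in Ioi (0 : ℝ),
      r • f (Complex.polarCoord.symm (r, θ)) := by
  rw [← Complex.integral_comp_polarCoord_symm, polarCoord_target]
  rw [IntegrableOn, Measure.volume_eq_prod, ← Measure.prod_restrict] at hf
  rw [Measure.volume_eq_prod, ← Measure.prod_restrict, integral_prod_symm _ hf]

/-- A linear parametrization of the tangent plane at `x` by the complex plane, orthonormal for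
`kleinForm x` and with its real axis in the direction of `x`. -/
lemma exists_kleinFrame {x : EuclideanSpace ℝ (Fin 2)} (hx : ‖x‖ < 1) :
    ∃ ψ : ℂ → EuclideanSpace ℝ (Fin 2), (∀ z, kleinNorm x (ψ z) = ‖z‖) ∧
      (∀ z, inner ℝ x (ψ z) = ‖x‖ * z.re) ∧
      ∀ g : EuclideanSpace ℝ (Fin 2) → ℝ,
        ∫ y, g y = (√(1 - ‖x‖ ^ 2))⁻¹ * ∫ z, g (ψ z) := by
  have hd := one_sub_norm_sq_pos hx
  set κ := √(1 - ‖x‖ ^ 2) with hκ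
  have hκ0 : 0 < κ := Real.sqrt_pos.2 hd
  have hκ2 : κ ^ 2 = 1 - ‖x‖ ^ 2 := Real.sq_sqrt hd.le
  have hn : ‖x‖ ^ 2 = x 0 ^ 2 + x 1 ^ 2 := by
    simp [EuclideanSpace.norm_sq_eq, Fin.sum_univ_two]
  obtain ⟨c, s, hcs, hc, hs⟩ : ∃ c s : ℝ, c ^ 2 + s ^ 2 = 1 ∧ x 0 = ‖x‖ * c ∧ x 1 = ‖x‖ * s := by
    rcases eq_or_ne x 0 with rfl | h0
    · exact ⟨1, 0, by norm_num, by simp, by simp⟩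
    · have : ‖x‖ ≠ 0 := norm_ne_zero_iff.2 h0
      refine ⟨x 0 / ‖x‖, x 1 / ‖x‖, ?_, by field_simp, by field_simp⟩
      rw [div_pow, div_pow, ← add_div, ← hn]
      field_simp
  set L : ℂ →ₗ[ℝ] ℂ := Matrix.toLin Complex.basisOneI Complex.basisOneI
    !![c, -s / κ; s, c / κ] with hL
  have hdet : LinearMap.det L = κ⁻¹ := by
    rw [hL, LinearMap.det_toLin, Matrix.det_fin_two_of]
    field_simp
    linear_combination hcs
  have hdet0 : LinearMap.det L ≠ 0 := by rw [hdet]; positivity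
  have hLz : ∀ z, L z = ⟨c * z.re - s / κ * z.im, s * z.re + c / κ * z.im⟩ := by
    intro z
    rw [hL, Matrix.toLin_apply]
    apply Complex.ext <;>
      simp [Fin.sum_univ_two, Complex.coe_basisOneI_repr, Complex.coe_basisOneI,
        Matrix.mulVec, dotProduct]
    ring
  have hin : ∀ z, inner ℝ x (Complex.orthonormalBasisOneI.repr (L z)) = ‖x‖ * z.re := by
    intro z
    simp only [PiLp.inner_apply, Fin.sum_univ_two,
      Complex.orthonormalBasisOneI_repr_apply, hLz]
    rw [hc, hs]
    simp
    linear_combination (‖x‖ * z.re) * hcs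
  refine ⟨fun z => Complex.orthonormalBasisOneI.repr (L z), ?_, ?_, ?_⟩
  · intro z
    rw [kleinNorm, Complex.norm_def, Complex.normSq_apply, kleinForm, hin, ← hκ2]
    congr 1
    have h1 : inner ℝ (Complex.orthonormalBasisOneI.repr (L z))
        (Complex.orthonormalBasisOneI.repr (L z)) = z.re ^ 2 + (z.im / κ) ^ 2 := by
      simp only [PiLp.inner_apply, Fin.sum_univ_two,
        Complex.orthonormalBasisOneI_repr_apply, hLz]
      simp
      linear_combination (z.re ^ 2 + (z.im / κ) ^ 2) * hcs
    rw [h1]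
    field_simp
    linear_combination z.re ^ 2 * hκ2
  · exact hin
  · intro g
    have h1 := (Complex.orthonormalBasisOneI.repr.measurePreserving).integral_comp
      Complex.orthonormalBasisOneI.repr.toHomeomorph.measurableEmbedding g
    rw [← h1]
    have h2 := Measure.map_linearMap_addHaar_eq_smul_addHaar (volume : Measure ℂ) hdet0
    have hemb : MeasurableEmbedding L :=
      ((LinearEquiv.ofIsUnitDet (f := L) (v := Complex.basisOneI) (v' := Complex.basisOneI)
        (by rw [LinearMap.det_toMatrix]; exact hdet0.isUnit)
        ).toContinuousLinearEquiv).toHomeomorph.measurableEmbedding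
    have h3 := hemb.integral_map (μ := volume) (fun z => g (Complex.orthonormalBasisOneI.repr z))
    rw [h2, hdet, inv_inv, abs_of_pos hκ0, integral_smul_measure, ENNReal.toReal_ofReal hκ0.le] at h3
    rw [← h3, smul_eq_mul, inv_mul_cancel_left₀ hκ0.ne']

lemma integral_mul_indicator_ray {c : ℝ} (hc : 0 < c) (m : ℝ) :
    ∫ r in Ioi (0 : ℝ), r * (if r * c < 1 then m else 0) = m / (2 * c ^ 2) := by
  have h : ∀ r : ℝ, r * (if r * c < 1 then m else 0) =
      (Iio c⁻¹).indicator (fun r => r * m) r := by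
    intro r
    have : r * c < 1 ↔ r ∈ Iio c⁻¹ := by rw [mem_Iio, ← one_div, lt_div_iff₀ hc]
    simp only [this, indicator]
    split_ifs <;> simp
  simp_rw [h]
  rw [setIntegral_indicator measurableSet_Iio, Ioi_inter_Iio, ← integral_Ioc_eq_integral_Ioo,
    ← intervalIntegral.integral_of_le (by positivity), intervalIntegral.integral_mul_const,
    integral_id]
  field_simp
  ring

lemma integral_berwald_angular (r : ℝ) :
    ∫ θ in Ioo (-Real.pi) Real.pi, (1 + r * Real.cos θ) ^ 2 *
      (1 + 2 * r ^ 2 - 3 * (r * Real.cos θ) ^ 2) =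
      2 * Real.pi * (1 + r ^ 2 - r ^ 4 / 8) := by
  rw [← integral_Ioc_eq_integral_Ioo,
    ← intervalIntegral.integral_of_le (by linarith [Real.pi_pos])]
  have h : ∀ θ : ℝ, (1 + r * Real.cos θ) ^ 2 * (1 + 2 * r ^ 2 - 3 * (r * Real.cos θ) ^ 2) =
      (1 + 2 * r ^ 2) + (2 * r * (1 + 2 * r ^ 2)) * Real.cos θ +
      (r ^ 2 * (2 * r ^ 2 - 2)) * Real.cos θ ^ 2 + (- 6 * r ^ 3) * Real.cos θ ^ 3 +
      (- 3 * r ^ 4) * Real.cos θ ^ 4 := by intro θ; ring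
  simp_rw [h]
  have hi : ∀ (c : ℝ) (n : ℕ), IntervalIntegrable (fun θ => c * Real.cos θ ^ n) volume
      (-Real.pi) Real.pi := fun c n => (by fun_prop : Continuous _).intervalIntegrable _ _
  have hi1 : ∀ c : ℝ, IntervalIntegrable (fun θ => c * Real.cos θ) volume
      (-Real.pi) Real.pi := fun c => (by fun_prop : Continuous _).intervalIntegrable _ _
  rw [intervalIntegral.integral_add ((((intervalIntegrable_const).add (hi1 _)).add (hi _ _)).add
      (hi _ _)) (hi _ _),
    intervalIntegral.integral_add (((intervalIntegrable_const).add (hi1 _)).add (hi _ _)) (hi _ _),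
    intervalIntegral.integral_add ((intervalIntegrable_const).add (hi1 _)) (hi _ _),
    intervalIntegral.integral_add (intervalIntegrable_const) (hi1 _)]
  simp only [intervalIntegral.integral_const_mul, integral_cos_pow 1, integral_cos_pow 2,
    integral_cos_sq, integral_cos, intervalIntegral.integral_const, pow_one]
  simp
  ring

/-- The Holmes–Thompson area element of Berwald's metric in dimension two. -/
lemma holmesThompsonDensity_berwaldMetric {x : EuclideanSpace ℝ (Fin 2)} (hx : ‖x‖ < 1) :
    holmesThompsonDensity berwaldMetric x =
      (1 + ‖x‖ ^ 2 - ‖x‖ ^ 4 / 8) / (√(1 - ‖x‖ ^ 2) * (1 - ‖x‖ ^ 2) ^ 3) := by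
  obtain ⟨ψ, hψn, hψi, hψ⟩ := exists_kleinFrame hx
  have hd := one_sub_norm_sq_pos hx
  have hvol : volume.real (Metric.ball (0 : EuclideanSpace ℝ (Fin 2)) 1) = Real.pi := by
    rw [Measure.real, EuclideanSpace.volume_ball_fin_two]
    simp [Real.pi_pos.le]
  set ρ := ‖x‖ with hρ
  have hρ0 : 0 ≤ ρ := norm_nonneg x
  have hcos : ∀ θ : ℝ, 1 - ρ ≤ 1 + ρ * Real.cos θ := fun θ => by
    nlinarith [Real.neg_one_le_cos θ]
  -- On the ray of angle `θ` in the Klein frame, `F = r φ(θ)` and the determinant is `D(θ)`.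
  set φ : ℝ → ℝ := fun θ => (1 + ρ * Real.cos θ) ^ 2 / (1 - ρ ^ 2) ^ 2 with hφ
  set D : ℝ → ℝ := fun θ => (1 + ρ * Real.cos θ) ^ 6 *
    (1 + 2 * ρ ^ 2 - 3 * (ρ * Real.cos θ) ^ 2) / (1 - ρ ^ 2) ^ 7 with hD
  have hφpos : ∀ θ, 0 < φ θ := fun θ => by
    have := hcos θ
    have : 0 < 1 + ρ * Real.cos θ := by linarith
    positivity
  have hφle : ∀ θ, (1 - ρ) ^ 2 / (1 - ρ ^ 2) ^ 2 ≤ φ θ := fun θ => by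
    have := hcos θ
    have : 0 < 1 - ρ := by linarith
    simp only [hφ]
    gcongr
  set f : EuclideanSpace ℝ (Fin 2) → ℝ := indicator {y | berwaldMetric x y < 1}
    (fun y => (fundamentalTensor berwaldMetric x y).det) with hf
  have hray : ∀ p : ℝ × ℝ, 0 < p.1 →
      p.1 • f (ψ (Complex.polarCoord.symm p)) =
        p.1 * (if p.1 * φ p.2 < 1 then D p.2 else 0) := by
    intro p hp
    set z := Complex.polarCoord.symm p with hz
    have hzn : kleinNorm x (ψ z) = p.1 := by
      rw [hψn, hz, Complex.norm_polarCoord_symm, abs_of_pos hp]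
    have hzi : inner ℝ x (ψ z) = p.1 * (ρ * Real.cos p.2) := by
      rw [hψi, hz]; simp [-Complex.ofReal_cos]; ring
    have hy : ψ z ≠ 0 := by
      intro h
      rw [h] at hzn
      simp [kleinNorm, kleinForm] at hzn
      exact hp.ne hzn
    have hF : berwaldMetric x (ψ z) = p.1 * φ p.2 := by
      rw [berwaldMetric_eq, hzn, hzi, ← hρ]
      simp only [hφ]
      field_simp
    have hdet := det_fundamentalTensor_berwaldMetric hx hy (s := ρ * Real.cos p.2)
      (by rw [hzn, hzi]; field_simp)
    simp only [hf, indicator, mem_ofPred_eq, hF, hdet, smul_eq_mul]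
    rfl
  have hmeas : MeasurableSet {y | berwaldMetric x y < 1} := by
    apply measurableSet_lt _ measurable_const
    unfold berwaldMetric
    fun_prop
  have hint : IntegrableOn (fun p : ℝ × ℝ => p.1 • f (ψ (Complex.polarCoord.symm p)))
      (Ioi 0 ×ˢ Ioo (-Real.pi) Real.pi) := by
    have hms : MeasurableSet (Ioi (0 : ℝ) ×ˢ Ioo (-Real.pi) Real.pi) :=
      measurableSet_Ioi.prod measurableSet_Ioo
    rw [integrableOn_congr_fun (fun p hp => hray p hp.1) hms]
    set R := ((1 - ρ) ^ 2 / (1 - ρ ^ 2) ^ 2)⁻¹ with hR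
    have hlow : 0 < (1 - ρ) ^ 2 / (1 - ρ ^ 2) ^ 2 := by
      have : 0 < 1 - ρ := by linarith
      positivity
    have hDc : Continuous D := by simp only [hD]; fun_prop
    have hφc : Continuous φ := by simp only [hφ]; fun_prop
    obtain ⟨C, hC⟩ := (isCompact_Icc (a := -Real.pi) (b := Real.pi)).exists_bound_of_continuousOn
      hDc.continuousOn
    refine IntegrableOn.of_forall_sdiff_eq_zero
      (s := Ioo 0 R ×ˢ Ioo (-Real.pi) Real.pi) ?_ hms ?_
    · refine IntegrableOn.of_bound ?_ ?_ (R * C) ?_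
      · rw [Measure.volume_eq_prod, Measure.prod_prod]
        simp [ENNReal.mul_lt_top]
      · apply Measurable.aestronglyMeasurable
        refine measurable_fst.mul (Measurable.ite (measurableSet_lt (by fun_prop) (by fun_prop))
          (by fun_prop) (by fun_prop))
      · filter_upwards [ae_restrict_mem (measurableSet_Ioo.prod measurableSet_Ioo)] with p hp
        have hC' := hC p.2 (Ioo_subset_Icc_self hp.2)
        have hC0 := (norm_nonneg _).trans hC'
        rw [norm_mul]
        refine mul_le_mul ?_ ?_ (norm_nonneg _) ?_
        · rw [Real.norm_of_nonneg hp.1.1.le]; exact hp.1.2.le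
        · split_ifs
          · exact hC'
          · simpa using hC0
        · exact hp.1.1.le.trans hp.1.2.le
    · rintro p ⟨hp1, hp2⟩
      have hpR : R ≤ p.1 := by
        by_contra h
        exact hp2 ⟨⟨hp1.1, not_le.1 h⟩, hp1.2⟩
      have : ¬ p.1 * φ p.2 < 1 := by
        rw [not_lt]
        calc 1 = R * ((1 - ρ) ^ 2 / (1 - ρ ^ 2) ^ 2) := (inv_mul_cancel₀ hlow.ne').symm
          _ ≤ p.1 * φ p.2 := mul_le_mul hpR (hφle _) hlow.le (le_of_lt hp1.1)
      simp [this]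
  have hmain : ∫ y in {y | berwaldMetric x y < 1}, (fundamentalTensor berwaldMetric x y).det =
      (√(1 - ρ ^ 2))⁻¹ * (Real.pi * (1 + ρ ^ 2 - ρ ^ 4 / 8) / (1 - ρ ^ 2) ^ 3) := by
    rw [← integral_indicator hmeas, ← hf, hψ, integral_polar_rays _ hint]
    congr 1
    have h1 : ∀ θ : ℝ, ∫ r in Ioi (0 : ℝ), r • f (ψ (Complex.polarCoord.symm (r, θ))) =
        (1 / (2 * (1 - ρ ^ 2) ^ 3)) * ((1 + ρ * Real.cos θ) ^ 2 *
          (1 + 2 * ρ ^ 2 - 3 * (ρ * Real.cos θ) ^ 2)) := by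
      intro θ
      rw [setIntegral_congr_fun measurableSet_Ioi (fun r hr => hray (r, θ) hr)]
      refine (integral_mul_indicator_ray (hφpos θ) (D θ)).trans ?_
      have := hcos θ
      have : 0 < 1 + ρ * Real.cos θ := by linarith
      simp only [hφ, hD]
      generalize 1 - ρ ^ 2 = d at *
      generalize ρ * Real.cos θ = s at *
      field_simp
    simp_rw [h1]
    rw [integral_const_mul, integral_berwald_angular]
    field_simp
  rw [holmesThompsonDensity, hvol, hmain]
  have := Real.sqrt_pos.2 hd
  field_simp

/-! ### The shell theorem for the Cauchy kernel -/

lemma integrableOn_polarCoord_symm {F : Type*} [NormedAddCommGroup F] [NormedSpace ℝ F]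
    {f : ℂ → F} (hf : Integrable f) :
    IntegrableOn (fun p : ℝ × ℝ => p.1 • f (Complex.polarCoord.symm p))
      (Ioi 0 ×ˢ Ioo (-Real.pi) Real.pi) := by
  have h1 : Integrable (fun p : ℝ × ℝ => f (Complex.measurableEquivRealProd.symm p)) :=
    (Complex.volume_preserving_equiv_real_prod.symm).integrable_comp_of_integrable hf
  have h2 := (integrableOn_image_iff_integrableOn_abs_det_fderiv_smul volume
    polarCoord.open_target.measurableSet
    (fun p _ => (hasFDerivAt_polarCoord_symm p).hasFDerivWithinAt) polarCoord.symm.injOn _).1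
    (h1.integrableOn (s := polarCoord.symm '' polarCoord.target))
  rw [← polarCoord_target]
  refine (integrableOn_congr_fun (fun p hp => ?_) polarCoord.open_target.measurableSet).1 h2
  simp only [det_fderivPolarCoordSymm]
  rw [abs_of_pos hp.1, Complex.measurableEquivRealProd_symm_polarCoord_symm_apply]

lemma integral_polar_circles {F : Type*} [NormedAddCommGroup F] [NormedSpace ℝ F]
    [CompleteSpace F] {f : ℂ → F} (hf : Integrable f) :
    ∫ z, f z = ∫ r in Ioi (0 : ℝ), ∫ θ in Ioo (-Real.pi) Real.pi,
      r • f (Complex.polarCoord.symm (r, θ)) := by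
  have h := integrableOn_polarCoord_symm hf
  rw [← Complex.integral_comp_polarCoord_symm, polarCoord_target]
  rw [IntegrableOn, Measure.volume_eq_prod, ← Measure.prod_restrict] at h
  rw [Measure.volume_eq_prod, ← Measure.prod_restrict, integral_prod _ h]

lemma integral_circle_of_diffContOnCl {f : ℂ → ℂ} {r : ℝ} (hr : 0 < r)
    (hf : DiffContOnCl ℂ f (Metric.ball 0 r)) :
    ∫ θ in Ioo (-Real.pi) Real.pi, f (Complex.polarCoord.symm (r, θ)) = 2 * Real.pi * f 0 := by
  have h := DiffContOnCl.circleAverage (f := f) (c := 0) (R := r) (by rwa [abs_of_pos hr])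
  have hper : Function.Periodic (fun θ => f (circleMap 0 r θ)) (2 * Real.pi) :=
    fun θ => by simp [periodic_circleMap 0 r θ]
  have h2 := hper.intervalIntegral_add_eq (-Real.pi) 0
  rw [zero_add, show -Real.pi + 2 * Real.pi = Real.pi by ring] at h2
  rw [Real.circleAverage, ← h2, intervalIntegral.integral_of_le (by linarith [Real.pi_pos]),
    integral_Ioc_eq_integral_Ioo] at h
  have h3 : ∀ θ : ℝ, Complex.polarCoord.symm (r, θ) = circleMap 0 r θ := by
    intro θ
    simp [circleMap, Complex.exp_mul_I]
  simp_rw [h3]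
  rw [← h, Complex.real_smul]
  push_cast
  have : (Real.pi : ℂ) ≠ 0 := by exact_mod_cast Real.pi_ne_zero
  field_simp

/-- The mean of the Cauchy kernel over a circle about the origin: the circle acts on outer points
as if it were concentrated at the origin. -/
lemma integral_circle_inv_sub_of_lt {x : ℂ} {r : ℝ} (hr : 0 < r) (h : r < ‖x‖) :
    ∫ θ in Ioo (-Real.pi) Real.pi, (x - Complex.polarCoord.symm (r, θ))⁻¹ =
      2 * Real.pi / x := by
  have := integral_circle_of_diffContOnCl (f := fun q => (x - q)⁻¹) hr ?_
  · rw [this]; simp [div_eq_mul_inv]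
  · refine DifferentiableOn.diffContOnCl fun q hq => ?_
    rw [closure_ball _ hr.ne', mem_closedBall_zero_iff] at hq
    refine DifferentiableAt.differentiableWithinAt (DifferentiableAt.inv (by fun_prop) ?_)
    intro h0
    rw [sub_eq_zero] at h0
    rw [← h0] at hq
    linarith

/-- The mean of the Cauchy kernel over a circle about the origin vanishes inside the circle. -/
lemma integral_circle_inv_sub_of_gt {x : ℂ} {r : ℝ} (h : ‖x‖ < r) :
    ∫ θ in Ioo (-Real.pi) Real.pi, (x - Complex.polarCoord.symm (r, θ))⁻¹ = 0 := by
  have hr : 0 < r := (norm_nonneg x).trans_lt h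
  -- On the circle `|q| = r`, the kernel is the conjugate of a function holomorphic in the disc.
  have hconj : ∀ θ : ℝ, (x - Complex.polarCoord.symm (r, θ))⁻¹ =
      (starRingEnd ℂ) ((fun q => q / ((starRingEnd ℂ) x * q - r ^ 2))
        (Complex.polarCoord.symm (r, θ))) := by
    intro θ
    set q := Complex.polarCoord.symm (r, θ) with hq
    have hqn : ‖q‖ = r := by rw [hq, Complex.norm_polarCoord_symm, abs_of_pos hr]
    have hq0 : (starRingEnd ℂ) q ≠ 0 := by
      rw [Ne, map_eq_zero, ← norm_eq_zero, hqn]; exact hr.ne'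
    have hqq : (starRingEnd ℂ) q * q = r ^ 2 := by
      rw [← Complex.normSq_eq_conj_mul_self, Complex.normSq_eq_norm_sq, hqn]; push_cast; rfl
    simp only [map_div₀, map_sub, map_mul, map_pow, Complex.conj_conj, Complex.conj_ofReal]
    rw [← hqq, show x * (starRingEnd ℂ) q - (starRingEnd ℂ) q * q = (starRingEnd ℂ) q * (x - q) by
      ring, div_mul_eq_div_div, div_self hq0, one_div]
  have := integral_circle_of_diffContOnCl
    (f := fun q => q / ((starRingEnd ℂ) x * q - r ^ 2)) hr ?_
  · simp_rw [hconj]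
    rw [integral_conj, this]
    simp
  · refine DifferentiableOn.diffContOnCl fun q hq => ?_
    rw [closure_ball _ hr.ne', mem_closedBall_zero_iff] at hq
    refine DifferentiableAt.differentiableWithinAt (DifferentiableAt.div (by fun_prop)
      (by fun_prop) ?_)
    intro h0
    rw [sub_eq_zero] at h0
    have h1 := congrArg norm h0
    rw [norm_mul, RCLike.norm_conj, norm_pow, Complex.norm_real, Real.norm_of_nonneg hr.le] at h1
    nlinarith [norm_nonneg x, norm_nonneg q]

/-- Newton's shell theorem in the plane: the Cauchy transform of a radial density at `x` only sees
the mass in the disc of radius `|x|`, as if it were concentrated at the origin. -/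
lemma integral_ball_radial_mul_inv_sub {g : ℝ → ℝ} {R : ℝ} {x : ℂ} (hx : ‖x‖ ≤ R)
    (hg : IntegrableOn (fun q : ℂ => (g ‖q‖ : ℂ) * (x - q)⁻¹) (Metric.ball 0 R)) :
    ∫ q in Metric.ball (0 : ℂ) R, (g ‖q‖ : ℂ) * (x - q)⁻¹ =
      (∫ r in (0 : ℝ)..‖x‖, r * g r : ℝ) * (2 * Real.pi / x) := by
  rw [← integral_indicator measurableSet_ball,
    integral_polar_circles (hg.integrable_indicator measurableSet_ball)]
  have h1 : ∀ᵐ r : ℝ, r ∈ Ioi (0 : ℝ) → ∫ θ in Ioo (-Real.pi) Real.pi,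
      r • (Metric.ball (0 : ℂ) R).indicator (fun q => (g ‖q‖ : ℂ) * (x - q)⁻¹)
        (Complex.polarCoord.symm (r, θ)) =
      (Iio ‖x‖).indicator (fun r => ((r * g r : ℝ) : ℂ) * (2 * Real.pi / x)) r := by
    filter_upwards [Measure.ae_ne volume ‖x‖] with r hrx hr
    rw [mem_Ioi] at hr
    have hn : ∀ θ : ℝ, ‖Complex.polarCoord.symm (r, θ)‖ = r := fun θ => by
      rw [Complex.norm_polarCoord_symm, abs_of_pos hr]
    have h2 : ∀ θ : ℝ, r • (Metric.ball (0 : ℂ) R).indicator (fun q => (g ‖q‖ : ℂ) * (x - q)⁻¹)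
        (Complex.polarCoord.symm (r, θ)) =
        (if r < R then ((r * g r : ℝ) : ℂ) else 0) * (x - Complex.polarCoord.symm (r, θ))⁻¹ := by
      intro θ
      simp only [indicator, mem_ball_zero_iff, hn]
      split_ifs
      · rw [Complex.real_smul]; push_cast; ring
      · simp
    simp_rw [h2]
    rw [integral_const_mul]
    rcases lt_or_gt_of_ne hrx with h | h
    · rw [integral_circle_inv_sub_of_lt hr h, indicator_of_mem (mem_Iio.2 h), if_pos (h.trans_le hx)]
    · rw [integral_circle_inv_sub_of_gt h, indicator_of_notMem (by simpa using h.le), mul_zero]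
  rw [setIntegral_congr_ae measurableSet_Ioi h1, setIntegral_indicator measurableSet_Iio,
    Ioi_inter_Iio, integral_mul_const, ← integral_Ioc_eq_integral_Ioo,
    ← intervalIntegral.integral_of_le (norm_nonneg x), intervalIntegral.integral_ofReal]

lemma integrableOn_ball_norm_inv (R : ℝ) :
    IntegrableOn (fun q : ℂ => ‖q‖⁻¹) (Metric.ball 0 R) := by
  rw [integrableOn_fun_norm_addHaar volume (f := fun r => r⁻¹)]
  rw [Complex.finrank_real_complex]
  refine (integrableOn_congr_fun (fun r hr => ?_) measurableSet_Ioo).2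
    (integrableOn_const (C := (1 : ℝ)) (by simp))
  simp [hr.1.ne']

/-- The Cauchy kernel is integrable on discs, uniformly in the position of its pole. -/
lemma exists_bound_integral_inv_sub (R : ℝ) :
    ∃ M : ℝ, ∀ x : ℂ, ‖x‖ < R → IntegrableOn (fun q : ℂ => ‖(x - q)⁻¹‖) (Metric.ball 0 R) ∧
      ∫ q in Metric.ball (0 : ℂ) R, ‖(x - q)⁻¹‖ ≤ M := by
  refine ⟨∫ q in Metric.ball (0 : ℂ) (2 * R), ‖q‖⁻¹, fun x hx => ?_⟩
  have h0 := (integrableOn_ball_norm_inv (2 * R)).integrable_indicator measurableSet_ball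
  have h1 := h0.comp_sub_left x
  have h2 : IntegrableOn (fun q : ℂ => ‖(x - q)⁻¹‖) (Metric.ball 0 R) ∧ ∀ q ∈ Metric.ball (0 : ℂ) R,
      ‖(x - q)⁻¹‖ = (Metric.ball (0 : ℂ) (2 * R)).indicator (fun q => ‖q‖⁻¹) (x - q) := by
    have h3 : ∀ q ∈ Metric.ball (0 : ℂ) R,
      ‖(x - q)⁻¹‖ = (Metric.ball (0 : ℂ) (2 * R)).indicator (fun q => ‖q‖⁻¹) (x - q) := by
      intro q hq
      rw [mem_ball_zero_iff] at hq
      rw [indicator_of_mem, norm_inv]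
      rw [mem_ball_zero_iff]
      linarith [norm_sub_le x q]
    exact ⟨(integrableOn_congr_fun h3 measurableSet_ball).2 h1.integrableOn, h3⟩
  refine ⟨h2.1, ?_⟩
  rw [setIntegral_congr_fun measurableSet_ball h2.2]
  refine (setIntegral_le_integral h1 (Filter.Eventually.of_forall fun q => ?_)).trans_eq ?_
  · exact indicator_nonneg (fun _ _ => inv_nonneg.2 (norm_nonneg _)) _
  · rw [integral_sub_left_eq_self _ volume x, integral_indicator measurableSet_ball]

/-! ### Winding integrals of closed curves -/

section Cauchy

variable {z z' : ℝ → ℂ} {a b : ℝ}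

/-- Fubini's theorem for a radial density against the winding integral of a curve, with the inner
integral evaluated by the shell theorem. -/
lemma integral_ball_radial_mul_cauchy (hab : a ≤ b) (hz : ContinuousOn z (Icc a b))
    (hz' : IntervalIntegrable z' volume a b) {g : ℝ → ℝ} {R C : ℝ}
    (hR : ∀ t ∈ Icc a b, ‖z t‖ < R) (hg : Measurable g) (hC : ∀ r, 0 ≤ r → r < R → |g r| ≤ C) :
    IntegrableOn (fun q : ℂ => (g ‖q‖ : ℂ) * ∫ t in a..b, z' t * (z t - q)⁻¹)
      (Metric.ball 0 R) ∧
    ∫ q in Metric.ball (0 : ℂ) R, (g ‖q‖ : ℂ) * ∫ t in a..b, z' t * (z t - q)⁻¹ =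
      ∫ t in a..b, z' t * ((∫ r in (0 : ℝ)..‖z t‖, r * g r : ℝ) * (2 * Real.pi / z t)) := by
  have hC0 : 0 ≤ C := by
    have := hR a ⟨le_rfl, hab⟩
    exact (abs_nonneg _).trans (hC _ (norm_nonneg (z a)) this)
  obtain ⟨M, hM⟩ := exists_bound_integral_inv_sub R
  have hM0 : 0 ≤ M := (integral_nonneg fun _ => norm_nonneg _).trans
    (hM _ (hR a ⟨le_rfl, hab⟩)).2
  have hgm : Measurable (fun q : ℂ => (g ‖q‖ : ℂ)) :=
    Complex.measurable_ofReal.comp (hg.comp measurable_norm)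
  have hgC : ∀ q ∈ Metric.ball (0 : ℂ) R, ‖(g ‖q‖ : ℂ)‖ ≤ C := fun q hq => by
    rw [Complex.norm_real]
    exact hC _ (norm_nonneg q) (mem_ball_zero_iff.1 hq)
  rw [intervalIntegrable_iff_integrableOn_Ioc_of_le hab] at hz'
  have hzm : AEStronglyMeasurable z (volume.restrict (Ioc a b)) :=
    (hz.mono Ioc_subset_Icc_self).aestronglyMeasurable measurableSet_Ioc
  -- The slices in `q` are dominated by `C |z'(t)| / |z(t) - q|`.
  have hslice : ∀ t ∈ Ioc a b,
      IntegrableOn (fun q : ℂ => (g ‖q‖ : ℂ) * (z t - q)⁻¹) (Metric.ball 0 R) ∧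
      ∫ q in Metric.ball (0 : ℂ) R, ‖(g ‖q‖ : ℂ) * (z t - q)⁻¹‖ ≤ C * M := by
    intro t ht
    obtain ⟨h1, h2⟩ := hM _ (hR t (Ioc_subset_Icc_self ht))
    have hb : ∀ᵐ q ∂(volume.restrict (Metric.ball (0 : ℂ) R)),
        ‖(g ‖q‖ : ℂ) * (z t - q)⁻¹‖ ≤ C * ‖(z t - q)⁻¹‖ := by
      filter_upwards [ae_restrict_mem measurableSet_ball] with q hq
      rw [norm_mul]
      exact mul_le_mul_of_nonneg_right (hgC q hq) (norm_nonneg _)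
    have h3 : IntegrableOn (fun q : ℂ => (g ‖q‖ : ℂ) * (z t - q)⁻¹) (Metric.ball 0 R) :=
      Integrable.mono' (h1.const_mul C)
        (hgm.mul (measurable_const.sub measurable_id).inv).aestronglyMeasurable hb
    refine ⟨h3, ?_⟩
    calc _ ≤ ∫ q in Metric.ball (0 : ℂ) R, C * ‖(z t - q)⁻¹‖ :=
          integral_mono_ae h3.norm (h1.const_mul C) hb
      _ ≤ C * M := by
          rw [integral_const_mul]
          exact mul_le_mul_of_nonneg_left h2 hC0
  have hprod : Integrable (fun p : ℝ × ℂ => z' p.1 * ((g ‖p.2‖ : ℂ) * (z p.1 - p.2)⁻¹))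
      ((volume.restrict (Ioc a b)).prod (volume.restrict (Metric.ball (0 : ℂ) R))) := by
    have hmeas : AEStronglyMeasurable
        (fun p : ℝ × ℂ => z' p.1 * ((g ‖p.2‖ : ℂ) * (z p.1 - p.2)⁻¹))
        ((volume.restrict (Ioc a b)).prod (volume.restrict (Metric.ball (0 : ℂ) R))) := by
      refine hz'.aestronglyMeasurable.comp_fst.mul (AEStronglyMeasurable.mul
        (hgm.comp measurable_snd).aestronglyMeasurable ?_)
      exact (hzm.comp_fst.sub
        measurable_snd.aestronglyMeasurable).aemeasurable.inv.aestronglyMeasurable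
    rw [integrable_prod_iff hmeas]
    constructor
    · filter_upwards [ae_restrict_mem measurableSet_Ioc] with t ht
      exact (hslice t ht).1.const_mul (z' t)
    · refine Integrable.mono' (hz'.norm.mul_const (C * M)) hmeas.norm.integral_prod_right' ?_
      filter_upwards [ae_restrict_mem measurableSet_Ioc] with t ht
      simp only [norm_mul (z' t)]
      rw [integral_const_mul, norm_mul, norm_norm,
        Real.norm_of_nonneg (integral_nonneg fun _ => norm_nonneg _)]
      exact mul_le_mul_of_nonneg_left (hslice t ht).2 (norm_nonneg _)
  have hpull : ∀ q : ℂ, (g ‖q‖ : ℂ) * ∫ t in a..b, z' t * (z t - q)⁻¹ =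
      ∫ t in Ioc a b, z' t * ((g ‖q‖ : ℂ) * (z t - q)⁻¹) := by
    intro q
    rw [intervalIntegral.integral_of_le hab, ← integral_const_mul]
    congr 1; funext t; ring
  simp_rw [hpull]
  refine ⟨hprod.integral_prod_right, ?_⟩
  rw [← integral_integral_swap hprod, intervalIntegral.integral_of_le hab]
  refine setIntegral_congr_fun measurableSet_Ioc fun t ht => ?_
  rw [integral_const_mul, integral_ball_radial_mul_inv_sub
    (hR t (Ioc_subset_Icc_self ht)).le (hslice t ht).1]

/-- The logarithmic derivative of a closed curve in the slit plane has integral zero. -/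
lemma integral_eq_zero_of_mem_slitPlane {f h : ℝ → ℂ} (hab : a ≤ b) {S : Set ℝ}
    (hS : S.Countable) (hf : ContinuousOn f (Icc a b))
    (hfs : ∀ t ∈ Icc a b, f t ∈ Complex.slitPlane)
    (hd : ∀ t ∈ Ioo a b \ S, HasDerivAt f (f t * h t) t) (hfab : f a = f b)
    (hh : IntervalIntegrable h volume a b) : ∫ t in a..b, h t = 0 := by
  have := integral_eq_of_hasDerivAt_off_countable_of_le (fun t => Complex.log (f t)) h hab hS
    (hf.clog hfs) (fun t ht => ?_) hh
  · rw [this, hfab, sub_self]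
  · have h0 := hfs t (Ioo_subset_Icc_self ht.1)
    refine ((hd t ht).clog_real h0).congr_deriv ?_
    rw [mul_div_cancel_left₀ _ (Complex.slitPlane_ne_zero h0)]

lemma intervalIntegrable_mul_inv_sub (hab : a ≤ b) (hz : ContinuousOn z (Icc a b))
    (hz' : IntervalIntegrable z' volume a b) {q : ℂ} (hq : ∀ t ∈ Icc a b, z t ≠ q) :
    IntervalIntegrable (fun t => z' t * (z t - q)⁻¹) volume a b := by
  refine hz'.mul_continuousOn ?_
  rw [uIcc_of_le hab]
  exact (hz.sub continuousOn_const).inv₀ fun t ht => sub_ne_zero.2 (hq t ht)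

/-- The winding integral `∮ dz / (z - q)` of a closed curve does not change under small
displacements of `q`: if `q` is closer to `q₀` than the curve, then `(z - q) / (z - q₀)` stays in
the right half plane. -/
lemma eventually_integral_mul_inv_sub_eq (hab : a ≤ b) (hz : ContinuousOn z (Icc a b))
    (hz' : IntervalIntegrable z' volume a b) {S : Set ℝ} (hS : S.Countable)
    (hd : ∀ t ∈ Ioo a b \ S, HasDerivAt z (z' t) t) (hzab : z a = z b)
    {q₀ : ℂ} (hq₀ : q₀ ∉ z '' Icc a b) :
    ∀ᶠ q in nhds q₀, ∫ t in a..b, z' t * (z t - q)⁻¹ = ∫ t in a..b, z' t * (z t - q₀)⁻¹ := by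
  obtain ⟨ε, hε, hball⟩ := Metric.isOpen_iff.1
    (isCompact_Icc.image_of_continuousOn hz).isClosed.isOpen_compl q₀ hq₀
  filter_upwards [Metric.ball_mem_nhds q₀ hε] with q hq
  have hne : ∀ p ∈ Metric.ball q₀ ε, ∀ t ∈ Icc a b, z t ≠ p := fun p hp t ht h =>
    hball hp ⟨t, ht, h⟩
  have hne₀ := hne q₀ (Metric.mem_ball_self hε)
  have hi := intervalIntegrable_mul_inv_sub hab hz hz' (hne q hq)
  have hi₀ := intervalIntegrable_mul_inv_sub hab hz hz' hne₀
  rw [← sub_eq_zero, ← intervalIntegral.integral_sub hi hi₀]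
  refine integral_eq_zero_of_mem_slitPlane (f := fun t => (z t - q) / (z t - q₀)) hab hS
    ((hz.sub continuousOn_const).div (hz.sub continuousOn_const)
      fun t ht => sub_ne_zero.2 (hne₀ t ht)) ?_ ?_ (by simp only [hzab]) (hi.sub hi₀)
  · intro t ht
    have h0 := sub_ne_zero.2 (hne₀ t ht)
    have h1 : (z t - q) / (z t - q₀) = 1 + (q₀ - q) / (z t - q₀) := by
      field_simp; ring
    rw [h1]
    apply Complex.mem_slitPlane_of_norm_lt_one
    rw [norm_div, div_lt_one (norm_pos_iff.2 h0)]
    have h2 : ¬ dist (z t) q₀ < ε := fun h => hball (Metric.mem_ball.2 h) ⟨t, ht, rfl⟩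
    rw [dist_eq_norm] at h2
    rw [Metric.mem_ball, dist_comm, dist_eq_norm] at hq
    linarith
  · intro t ht
    have h0 := sub_ne_zero.2 (hne₀ t (Ioo_subset_Icc_self ht.1))
    have h1 := sub_ne_zero.2 (hne q hq t (Ioo_subset_Icc_self ht.1))
    refine (((hd t ht).sub_const q).div ((hd t ht).sub_const q₀) h0).congr_deriv ?_
    field_simp

/-- The winding integral of a closed curve vanishes about points farther from the origin than the
curve. -/
lemma integral_mul_inv_sub_eq_zero (hab : a ≤ b) (hz : ContinuousOn z (Icc a b))
    (hz' : IntervalIntegrable z' volume a b) {S : Set ℝ} (hS : S.Countable)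
    (hd : ∀ t ∈ Ioo a b \ S, HasDerivAt z (z' t) t) (hzab : z a = z b)
    {q : ℂ} (hq : ∀ t ∈ Icc a b, ‖z t‖ < ‖q‖) :
    ∫ t in a..b, z' t * (z t - q)⁻¹ = 0 := by
  have hne : ∀ t ∈ Icc a b, z t ≠ q := fun t ht h => by
    have := hq t ht
    rw [h] at this
    exact lt_irrefl _ this
  have hq0 : q ≠ 0 := norm_pos_iff.1 ((norm_nonneg _).trans_lt (hq a ⟨le_rfl, hab⟩))
  refine integral_eq_zero_of_mem_slitPlane (f := fun t => 1 + -(z t / q)) hab hS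
    (continuousOn_const.add (hz.div_const q).neg) ?_ ?_ (by simp only [hzab])
    (intervalIntegrable_mul_inv_sub hab hz hz' hne)
  · intro t ht
    apply Complex.mem_slitPlane_of_norm_lt_one
    rw [norm_neg, norm_div, div_lt_one (norm_pos_iff.2 hq0)]
    exact hq t ht
  · intro t ht
    have h1 := sub_ne_zero.2 (hne t (Ioo_subset_Icc_self ht.1))
    refine (((hd t ht).div_const q).neg.const_add 1).congr_deriv ?_
    field_simp
    ring

end Cauchy

lemma IsPreconnected.eq_of_eventually_eq {X Y : Type*} [TopologicalSpace X] {V : Set X}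
    (hV : IsPreconnected V) {f : X → Y} (hf : ∀ x ∈ V, ∀ᶠ y in nhds x, f y = f x) {x y : X}
    (hx : x ∈ V) (hy : y ∈ V) : f x = f y := by
  have := isPreconnected_iff_preconnectedSpace.1 hV
  have hl : IsLocallyConstant (fun v : V => f v) := by
    rw [IsLocallyConstant.iff_eventually_eq]
    exact fun v => continuous_subtype_val.continuousAt.eventually (hf v v.2)
  exact hl.apply_eq_of_preconnectedSpace ⟨x, hx⟩ ⟨y, hy⟩

/-! ### Plane curves and the regions they enclose -/

section Curve

lemma exists_mem_Ioo_of_monotone {p : ℕ → ℝ} {m : ℕ} {t : ℝ}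
    (h0 : p 0 ≤ t) (hm : t ≤ p m) (hne : t ∉ p '' Iic m) :
    ∃ i < m, t ∈ Ioo (p i) (p (i + 1)) := by
  induction m with
  | zero => exact absurd ⟨0, by simp, le_antisymm h0 hm⟩ hne
  | succ m ih =>
    rcases le_or_gt t (p m) with h | h
    · obtain ⟨i, hi, hit⟩ := ih h fun ⟨j, hj, hjt⟩ => hne ⟨j, by simp at hj ⊢; omega, hjt⟩
      exact ⟨i, by omega, hit⟩
    · exact ⟨m, by omega, h, lt_of_le_of_ne hm fun h' => hne ⟨m + 1, by simp, h'.symm⟩⟩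

variable {c : ℝ → EuclideanSpace ℝ (Fin 2)} {a b : ℝ}

lemma IsPiecewiseC1.exists_deriv_bound (hc : IsPiecewiseC1 c a b) :
    ∃ S : Set ℝ, S.Countable ∧ ∃ C : ℝ, ∀ t ∈ Ioo a b \ S,
      DifferentiableAt ℝ c t ∧ ‖deriv c t‖ ≤ C := by
  obtain ⟨-, m, p, -, rfl, rfl, hC1⟩ := hc
  have hpiece : ∀ i, ∃ C : ℝ, i < m → ∀ t ∈ Ioo (p i) (p (i + 1)),
      DifferentiableAt ℝ c t ∧ ‖deriv c t‖ ≤ C := by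
    intro i
    by_cases hi : i < m
    · rcases lt_or_ge (p i) (p (i + 1)) with hlt | hge
      · have hcont := (hC1 i hi).continuousOn_derivWithin (uniqueDiffOn_Icc hlt) le_rfl
        obtain ⟨C, hC⟩ := isCompact_Icc.exists_bound_of_continuousOn hcont
        refine ⟨C, fun _ t ht => ?_⟩
        have hn := Icc_mem_nhds ht.1 ht.2
        refine ⟨((hC1 i hi).differentiableOn one_ne_zero t (Ioo_subset_Icc_self ht)).differentiableAt
          hn, ?_⟩
        rw [← derivWithin_of_mem_nhds hn]
        exact hC t (Ioo_subset_Icc_self ht)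
      · exact ⟨0, fun _ t ht => absurd (ht.1.trans ht.2) hge.not_gt⟩
    · exact ⟨0, fun h => absurd h hi⟩
  choose C hC using hpiece
  refine ⟨p '' Iic m, ((finite_Iic m).image p).countable, ∑ i ∈ Finset.range m, |C i|, ?_⟩
  intro t ht
  obtain ⟨i, hi, hit⟩ := exists_mem_Ioo_of_monotone ht.1.1.le ht.1.2.le ht.2
  refine ⟨(hC i hi t hit).1, ((hC i hi t hit).2.trans (le_abs_self _)).trans ?_⟩
  exact Finset.single_le_sum (f := fun i => |C i|) (fun _ _ => abs_nonneg _)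
    (Finset.mem_range.2 hi)

/-- The trace of a piecewise `C¹` plane curve is a null set, being of Hausdorff dimension at most
one. -/
lemma IsPiecewiseC1.volume_image_eq_zero (hc : IsPiecewiseC1 c a b) :
    volume (c '' Icc a b) = 0 := by
  obtain ⟨-, m, p, -, rfl, rfl, hC1⟩ := hc
  have hac : (volume : Measure (EuclideanSpace ℝ (Fin 2))) ≪ Measure.hausdorffMeasure 2 := by
    rw [← EuclideanSpace.euclideanHausdorffMeasure_eq_volume 2,
      Measure.euclideanHausdorffMeasure_def]
    exact Measure.smul_absolutelyContinuous
  have hpiece : ∀ i < m, volume (c '' Icc (p i) (p (i + 1))) = 0 := by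
    intro i hi
    refine measure_zero_of_dimH_lt (d := 2) hac ?_
    calc dimH (c '' Icc (p i) (p (i + 1))) ≤ dimH (Icc (p i) (p (i + 1))) :=
          (hC1 i hi).dimH_image_le (convex_Icc _ _) Subset.rfl
      _ ≤ dimH (univ : Set ℝ) := dimH_mono (subset_univ _)
      _ = 1 := Real.dimH_univ
      _ < _ := by norm_num
  have hcover : c '' Icc (p 0) (p m) ⊆
      c '' (p '' Iic m) ∪ ⋃ i ∈ Finset.range m, c '' Icc (p i) (p (i + 1)) := by
    rintro _ ⟨t, ht, rfl⟩
    by_cases h : t ∈ p '' Iic m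
    · exact Or.inl ⟨t, h, rfl⟩
    · obtain ⟨i, hi, hit⟩ := exists_mem_Ioo_of_monotone ht.1 ht.2 h
      exact Or.inr (mem_biUnion (Finset.mem_coe.2 (Finset.mem_range.2 hi))
        ⟨t, Ioo_subset_Icc_self hit, rfl⟩)
  refine measure_mono_null hcover (measure_union_null ?_ ?_)
  · exact (((finite_Iic m).image p).image c).measure_zero _
  · exact (measure_biUnion_null_iff (Finset.countable_toSet _)).2 fun i hi =>
      hpiece i (Finset.mem_range.1 hi)

lemma exists_norm_ge_mem_of_not_isBounded {V : Set (EuclideanSpace ℝ (Fin 2))}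
    (hV : ¬ Bornology.IsBounded V) (R : ℝ) : ∃ q ∈ V, R ≤ ‖q‖ := by
  by_contra! h
  exact hV (Metric.isBounded_ball.subset fun q hq => mem_ball_zero_iff.2 (h q hq))

lemma enclosedRegion_subset_ball {R : ℝ} (hab : a ≤ b) (hR : ∀ t ∈ Icc a b, ‖c t‖ < R) :
    enclosedRegion c a b ⊆ Metric.ball 0 R := by
  intro q hq
  by_contra hqR
  rw [mem_ball_zero_iff, not_lt] at hqR
  have hR0 : 0 < R := (norm_nonneg _).trans_lt (hR a ⟨le_rfl, hab⟩)
  -- The radial ray from `q` to infinity avoids the curve.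
  have hray : (fun s : ℝ => s • q) '' Ici 1 ⊆ connectedComponentIn (c '' Icc a b)ᶜ q := by
    refine IsPreconnected.subset_connectedComponentIn ?_ ⟨1, by simp, by simp⟩ ?_
    · exact isPreconnected_Ici.image _ (by fun_prop)
    · rintro _ ⟨s, hs, rfl⟩ ⟨t, ht, hts⟩
      have h1 := hR t ht
      rw [hts, norm_smul, Real.norm_of_nonneg (zero_le_one.trans hs)] at h1
      nlinarith [norm_nonneg q, mem_Ici.1 hs]
  obtain ⟨M, hM⟩ := isBounded_iff_forall_norm_le.1 (hq.2.subset hray)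
  have hq0 : 0 < ‖q‖ := hR0.trans_le hqR
  have h1 : (1 : ℝ) ≤ 1 + |M| / ‖q‖ := by
    have : 0 ≤ |M| / ‖q‖ := by positivity
    linarith
  have h2 := hM _ ⟨1 + |M| / ‖q‖, h1, rfl⟩
  rw [norm_smul, Real.norm_of_nonneg (zero_le_one.trans h1), add_mul,
    div_mul_cancel₀ _ hq0.ne'] at h2
  linarith [le_abs_self M]

lemma isOpen_enclosedRegion (hc : ContinuousOn c (Icc a b)) : IsOpen (enclosedRegion c a b) := by
  have hU : IsOpen (c '' Icc a b)ᶜ := (isCompact_Icc.image_of_continuousOn hc).isClosed.isOpen_compl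
  rw [isOpen_iff_forall_mem_open]
  intro q hq
  refine ⟨connectedComponentIn (c '' Icc a b)ᶜ q, fun y hy => ⟨?_, ?_⟩, hU.connectedComponentIn,
    mem_connectedComponentIn hq.1⟩
  · exact connectedComponentIn_subset _ _ hy
  · rw [← connectedComponentIn_eq hy]; exact hq.2

/-- The identification of the Euclidean plane with the complex numbers. -/
noncomputable def planeToComplex : EuclideanSpace ℝ (Fin 2) ≃ₗᵢ[ℝ] ℂ :=
  Complex.orthonormalBasisOneI.repr.symm

lemma planeToComplex_apply (q : EuclideanSpace ℝ (Fin 2)) : planeToComplex q = ⟨q 0, q 1⟩ := by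
  rw [planeToComplex, LinearIsometryEquiv.symm_apply_eq]
  ext i
  fin_cases i <;> simp [Complex.orthonormalBasisOneI_repr_apply]

lemma deriv_coord {t : ℝ} (h : DifferentiableAt ℝ c t) (i : Fin 2) :
    deriv (fun s => c s i) t = deriv c t i :=
  ((EuclideanSpace.proj (𝕜 := ℝ) i).hasFDerivAt.comp_hasDerivAt t h.hasDerivAt).deriv

/-- The winding number is the imaginary part of `(2π)⁻¹ ∮ dz / (z - q)`. -/
lemma curveWindingNumber_eq_im (hab : a ≤ b) {S : Set ℝ} (hS : S.Countable)
    (hd : ∀ t ∈ Ioo a b \ S, DifferentiableAt ℝ c t) {q : EuclideanSpace ℝ (Fin 2)}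
    (hi : IntervalIntegrable (fun t => planeToComplex (deriv c t) *
      (planeToComplex (c t) - planeToComplex q)⁻¹) volume a b) :
    curveWindingNumber c a b q = (1 / (2 * Real.pi)) * (∫ t in a..b,
      planeToComplex (deriv c t) * (planeToComplex (c t) - planeToComplex q)⁻¹).im := by
  rw [curveWindingNumber]
  congr 1
  rw [intervalIntegral.integral_of_le hab, intervalIntegral.integral_of_le hab]
  rw [intervalIntegrable_iff_integrableOn_Ioc_of_le hab] at hi
  have him := integral_im (𝕜 := ℂ) hi
  simp only [RCLike.im_to_complex] at him
  rw [← him, integral_Ioc_eq_integral_Ioo, integral_Ioc_eq_integral_Ioo]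
  refine setIntegral_congr_ae measurableSet_Ioo ?_
  filter_upwards [hS.ae_notMem volume] with t htS ht
  rw [deriv_coord (hd t ⟨ht, htS⟩), deriv_coord (hd t ⟨ht, htS⟩), ← map_sub,
    ← div_eq_mul_inv, Complex.div_im, Complex.normSq_eq_norm_sq, LinearIsometryEquiv.norm_map,
    planeToComplex_apply, planeToComplex_apply]
  simp
  ring

end Curve

/-! ### Radial densities and the enclosed area -/

/-- The Holmes–Thompson area density of Berwald's metric at distance `r` from the origin. -/
noncomputable def berwaldRadialDensity (r : ℝ) : ℝ :=
  (1 + r ^ 2 - r ^ 4 / 8) / (√(1 - r ^ 2) * (1 - r ^ 2) ^ 3)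

lemma continuousOn_berwaldRadialDensity : ContinuousOn berwaldRadialDensity (Ico 0 1) := by
  unfold berwaldRadialDensity
  refine ContinuousOn.div (by fun_prop) (by fun_prop) fun r hr => ?_
  have : 0 < 1 - r ^ 2 := by nlinarith [hr.1, hr.2]
  have := Real.sqrt_pos.2 this
  positivity

lemma integral_mul_berwaldRadialDensity {ρ : ℝ} (h0 : 0 ≤ ρ) (h1 : ρ < 1) :
    ∫ r in (0 : ℝ)..ρ, r * berwaldRadialDensity r =
      -(ρ ^ 2 * ((ρ ^ 2 - 4) / (1 - ρ ^ 2) ^ (5 / 2 : ℝ)) / 8) := by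
  have hpos : ∀ r ∈ uIcc 0 ρ, 0 < 1 - r ^ 2 := fun r hr => by
    rw [uIcc_of_le h0] at hr
    nlinarith [hr.1, hr.2]
  have hd : ∀ r ∈ uIcc 0 ρ, HasDerivAt
      (fun r => r ^ 2 * (4 - r ^ 2) / (8 * (√(1 - r ^ 2) * (1 - r ^ 2) ^ 2)))
      (r * berwaldRadialDensity r) r := by
    intro r hr
    have hp := hpos r hr
    have hw := Real.sqrt_pos.2 hp
    have hw2 := Real.sq_sqrt hp.le
    have e1 : HasDerivAt (fun r : ℝ => r ^ 2) (2 * r) r := by simpa using hasDerivAt_pow 2 r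
    have e2 := e1.const_sub 1
    have e3 := (e1.mul (e1.const_sub 4)).div (((e2.sqrt hp.ne').mul (e2.pow 2)).const_mul 8)
      (by simp only [Pi.mul_apply, Pi.pow_apply]; positivity)
    refine e3.congr_deriv ?_
    simp only [Pi.mul_apply, Pi.pow_apply, berwaldRadialDensity]
    set w := √(1 - r ^ 2)
    rw [← hw2]
    have hr2 : r ^ 2 = 1 - w ^ 2 := by linarith
    field_simp
    simp only [show r ^ 4 = (r ^ 2) ^ 2 by ring, hr2]
    ring
  have hint : IntervalIntegrable (fun r => r * berwaldRadialDensity r) volume 0 ρ := by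
    refine ContinuousOn.intervalIntegrable (continuousOn_id.mul
      (continuousOn_berwaldRadialDensity.mono ?_))
    rw [uIcc_of_le h0]
    exact fun r hr => ⟨hr.1, hr.2.trans_lt h1⟩
  rw [intervalIntegral.integral_eq_sub_of_hasDerivAt hd hint]
  have hp := hpos ρ right_mem_uIcc
  have hw := Real.sqrt_pos.2 hp
  rw [show (5 / 2 : ℝ) = 1 / 2 + (2 : ℕ) by norm_num, Real.rpow_add hp, Real.rpow_natCast,
    ← Real.sqrt_eq_rpow]
  field_simp
  ring

/-- The velocity of a piecewise `C¹` curve is integrable. -/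
lemma IsPiecewiseC1.intervalIntegrable_planeToComplex_deriv
    {c : ℝ → EuclideanSpace ℝ (Fin 2)} {t₀ t₁ : ℝ} (hc : IsPiecewiseC1 c t₀ t₁)
    (hab : t₀ ≤ t₁) :
    IntervalIntegrable (fun t => planeToComplex (deriv c t)) volume t₀ t₁ := by
  obtain ⟨S, hS, K, hK⟩ := hc.exists_deriv_bound
  rw [intervalIntegrable_iff_integrableOn_Ioc_of_le hab, integrableOn_Ioc_iff_integrableOn_Ioo]
  refine IntegrableOn.of_bound (by simp) (planeToComplex.continuous.measurable.comp
    (measurable_deriv c)).aestronglyMeasurable K ?_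
  filter_upwards [ae_restrict_mem measurableSet_Ioo, ae_restrict_of_ae (hS.ae_notMem volume)]
    with t ht htS
  rw [LinearIsometryEquiv.norm_map]
  exact (hK t ⟨ht, htS⟩).2

/-- Green's theorem for a radial density `g` and its rotationally symmetric primitive: the mass
enclosed by a positively oriented simple closed curve is a line integral along the curve. -/
lemma integral_enclosedRegion_radial {c : ℝ → EuclideanSpace ℝ (Fin 2)} {t₀ t₁ : ℝ}
    (hc : IsSimpleClosedCurve c t₀ t₁) (hor : IsPositivelyOriented c t₀ t₁) {g : ℝ → ℝ} {R C : ℝ}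
    (hR : ∀ t ∈ Icc t₀ t₁, ‖c t‖ < R) (hg : Measurable g) (hC : ∀ r, 0 ≤ r → r < R → |g r| ≤ C) :
    ∫ x in enclosedRegion c t₀ t₁, g ‖x‖ = (1 / (2 * Real.pi)) *
      (∫ t in t₀..t₁, planeToComplex (deriv c t) *
        ((∫ r in (0 : ℝ)..‖planeToComplex (c t)‖, r * g r : ℝ) *
          (2 * Real.pi / planeToComplex (c t)))).im := by
  have hab := hc.lt.le
  have hcc := hc.piecewiseC1.1
  obtain ⟨S, hS, K, hK⟩ := hc.piecewiseC1.exists_deriv_bound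
  set Ω := enclosedRegion c t₀ t₁ with hΩ
  have hΩR : Ω ⊆ Metric.ball 0 R := enclosedRegion_subset_ball hab hR
  have hΩm : MeasurableSet Ω := (isOpen_enclosedRegion hcc).measurableSet
  set z : ℝ → ℂ := fun t => planeToComplex (c t) with hz
  set z' : ℝ → ℂ := fun t => planeToComplex (deriv c t) with hz'
  have hzc : ContinuousOn z (Icc t₀ t₁) := planeToComplex.continuous.comp_continuousOn hcc
  have hzn : ∀ t, ‖z t‖ = ‖c t‖ := fun t => planeToComplex.norm_map _
  have hz'i : IntervalIntegrable z' volume t₀ t₁ :=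
    hc.piecewiseC1.intervalIntegrable_planeToComplex_deriv hab
  have hzd : ∀ t ∈ Ioo t₀ t₁ \ S, HasDerivAt z (z' t) t := fun t ht =>
    (planeToComplex.toContinuousLinearEquiv.toContinuousLinearMap.hasFDerivAt.comp_hasDerivAt t
      (hK t ht).1.hasDerivAt)
  have hzab : z t₀ = z t₁ := by simp only [hz, hc.closed]
  -- Off the curve, the winding number is the indicator function of the enclosed region.
  set W : EuclideanSpace ℝ (Fin 2) → ℂ := fun q =>
    ∫ t in t₀..t₁, z' t * (z t - planeToComplex q)⁻¹ with hW
  have hmem : ∀ q, planeToComplex q ∈ z '' Icc t₀ t₁ ↔ q ∈ c '' Icc t₀ t₁ := fun q =>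
    ⟨fun ⟨t, ht, h⟩ => ⟨t, ht, planeToComplex.injective h⟩, fun ⟨t, ht, h⟩ => ⟨t, ht, by
      simp only [hz, h]⟩⟩
  have hWin : ∀ q ∈ Ω, (W q).im = 2 * Real.pi := by
    intro q hq
    have h1 := hor q hq
    rw [curveWindingNumber_eq_im hab hS (fun t ht => (hK t ht).1)
      (intervalIntegrable_mul_inv_sub hab hzc hz'i
        fun t ht h => hq.1 ((hmem q).1 ⟨t, ht, h⟩))] at h1
    change 1 / (2 * Real.pi) * (W q).im = 1 at h1
    have := Real.pi_pos
    field_simp at h1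
    linarith
  have hWout : ∀ q, q ∉ c '' Icc t₀ t₁ → q ∉ Ω → W q = 0 := by
    intro q hq hqΩ
    obtain ⟨q', hq', hq'R⟩ := exists_norm_ge_mem_of_not_isBounded
      (fun h => hqΩ ⟨hq, h⟩ : ¬ Bornology.IsBounded (connectedComponentIn (c '' Icc t₀ t₁)ᶜ q)) R
    have h1 : W q = W q' := isPreconnected_connectedComponentIn.eq_of_eventually_eq
      (fun x hx => planeToComplex.continuous.continuousAt.eventually
        (eventually_integral_mul_inv_sub_eq hab hzc hz'i hS hzd hzab fun h =>
          (connectedComponentIn_subset _ _ hx : x ∈ (c '' Icc t₀ t₁)ᶜ) ((hmem x).1 h)))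
      (mem_connectedComponentIn hq) hq'
    rw [h1]
    refine integral_mul_inv_sub_eq_zero hab hzc hz'i hS hzd hzab fun t ht => ?_
    rw [hzn, LinearIsometryEquiv.norm_map]
    exact (hR t ht).trans_le hq'R
  obtain ⟨hFi, hF⟩ := integral_ball_radial_mul_cauchy hab hzc hz'i
    (fun t ht => (hzn t).trans_lt (hR t ht)) hg hC
  have hmp : MeasurePreserving planeToComplex := planeToComplex.measurePreserving
  have hpre : planeToComplex ⁻¹' Metric.ball 0 R = Metric.ball 0 R := by
    ext q
    simp
  have hemb : MeasurableEmbedding planeToComplex :=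
    planeToComplex.toHomeomorph.measurableEmbedding
  rw [← hF]
  have him := integral_im (𝕜 := ℂ) hFi
  simp only [RCLike.im_to_complex] at him
  rw [← him, ← hmp.setIntegral_preimage_emb hemb, hpre,
    ← integral_const_mul, ← inter_eq_self_of_subset_right hΩR, ← setIntegral_indicator hΩm]
  refine setIntegral_congr_ae measurableSet_ball ?_
  have htrace : ∀ᵐ q, q ∉ c '' Icc t₀ t₁ :=
    measure_eq_zero_iff_ae_notMem.1 hc.piecewiseC1.volume_image_eq_zero
  filter_upwards [htrace] with q hq _
  rw [Complex.im_ofReal_mul, LinearIsometryEquiv.norm_map]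
  change _ = 1 / (2 * Real.pi) * (g ‖q‖ * (W q).im)
  by_cases hqΩ : q ∈ Ω
  · rw [indicator_of_mem hqΩ, hWin q hqΩ]
    have := Real.pi_pos
    field_simp
  · rw [indicator_of_notMem hqΩ, hWout q hq hqΩ]
    simp

theorem theorem3p3 (c : ℝ → EuclideanSpace ℝ (Fin 2)) (t₀ t₁ : ℝ)
    (hc : IsSimpleClosedCurve c t₀ t₁)
    (hball : ∀ t ∈ Icc t₀ t₁, c t ∈ Metric.ball (0 : EuclideanSpace ℝ (Fin 2)) 1)
    (hor : IsPositivelyOriented c t₀ t₁) :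
    enclosedRegion c t₀ t₁ ⊆ Metric.ball (0 : EuclideanSpace ℝ (Fin 2)) 1 ∧
    IntegrableOn (holmesThompsonDensity (berwaldMetric (n := 2))) (enclosedRegion c t₀ t₁) ∧
    IntervalIntegrable
      (fun t => ((c t 0) ^ 2 + (c t 1) ^ 2 - 4) /
          (1 - (c t 0) ^ 2 - (c t 1) ^ 2) ^ (5 / 2 : ℝ) *
        (c t 1 * deriv (fun s => c s 0) t - c t 0 * deriv (fun s => c s 1) t))
      volume t₀ t₁ ∧
    holmesThompsonVolume (berwaldMetric (n := 2)) (enclosedRegion c t₀ t₁) =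
      (1 / 8) * ∫ t in t₀..t₁,
        ((c t 0) ^ 2 + (c t 1) ^ 2 - 4) /
          (1 - (c t 0) ^ 2 - (c t 1) ^ 2) ^ (5 / 2 : ℝ) *
        (c t 1 * deriv (fun s => c s 0) t - c t 0 * deriv (fun s => c s 1) t) := by
  have hab := hc.lt.le
  have hcc := hc.piecewiseC1.1
  obtain ⟨S, hS, K, hK⟩ := hc.piecewiseC1.exists_deriv_bound
  obtain ⟨R, hR1, hR⟩ : ∃ R : ℝ, R < 1 ∧ ∀ t ∈ Icc t₀ t₁, ‖c t‖ < R := by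
    obtain ⟨s, hs, hmax⟩ := isCompact_Icc.exists_isMaxOn ⟨t₀, left_mem_Icc.2 hab⟩ hcc.norm
    have h1 := mem_ball_zero_iff.1 (hball s hs)
    refine ⟨(‖c s‖ + 1) / 2, by linarith, fun t ht => ?_⟩
    have h2 : ‖c t‖ ≤ ‖c s‖ := hmax ht
    linarith
  set Ω := enclosedRegion c t₀ t₁ with hΩ
  have hΩR : Ω ⊆ Metric.ball 0 R := enclosedRegion_subset_ball hab hR
  have hΩm : MeasurableSet Ω := (isOpen_enclosedRegion hcc).measurableSet
  obtain ⟨C, hC⟩ := isCompact_Icc.exists_bound_of_continuousOn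
    (continuousOn_berwaldRadialDensity.mono fun r (hr : r ∈ Icc 0 R) =>
      ⟨hr.1, hr.2.trans_lt hR1⟩)
  have hgm : Measurable berwaldRadialDensity := by
    unfold berwaldRadialDensity
    fun_prop
  have hσ : ∀ x ∈ Metric.ball (0 : EuclideanSpace ℝ (Fin 2)) R,
      holmesThompsonDensity berwaldMetric x = berwaldRadialDensity ‖x‖ := fun x hx =>
    holmesThompsonDensity_berwaldMetric ((mem_ball_zero_iff.1 hx).trans hR1)
  have hσi : IntegrableOn (holmesThompsonDensity (berwaldMetric (n := 2))) Ω := by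
    refine IntegrableOn.mono_set ?_ hΩR
    refine (integrableOn_congr_fun hσ measurableSet_ball).2 ?_
    refine IntegrableOn.of_bound measure_ball_lt_top
      (hgm.comp measurable_norm).aestronglyMeasurable C ?_
    filter_upwards [ae_restrict_mem measurableSet_ball] with x hx
    exact hC _ ⟨norm_nonneg x, (mem_ball_zero_iff.1 hx).le⟩
  -- The line integrand is the imaginary part of the complex function `J`.
  set z : ℝ → ℂ := fun t => planeToComplex (c t) with hz
  set z' : ℝ → ℂ := fun t => planeToComplex (deriv c t) with hz'
  have hzc : ContinuousOn z (Icc t₀ t₁) := planeToComplex.continuous.comp_continuousOn hcc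
  have hzn : ∀ t, ‖z t‖ = ‖c t‖ := fun t => planeToComplex.norm_map _
  have hz'i : IntervalIntegrable z' volume t₀ t₁ :=
    hc.piecewiseC1.intervalIntegrable_planeToComplex_deriv hab
  set h : ℝ → ℝ := fun t => ((c t 0) ^ 2 + (c t 1) ^ 2 - 4) /
    (1 - (c t 0) ^ 2 - (c t 1) ^ 2) ^ (5 / 2 : ℝ) with hh
  have hnsq : ∀ t, ‖c t‖ ^ 2 = c t 0 ^ 2 + c t 1 ^ 2 := fun t => by
    simp [EuclideanSpace.norm_sq_eq, Fin.sum_univ_two]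
  have hpos : ∀ t ∈ Icc t₀ t₁, 0 < 1 - c t 0 ^ 2 - c t 1 ^ 2 := fun t ht => by
    have := hnsq t
    have := one_sub_norm_sq_pos ((hR t ht).trans hR1)
    linarith
  have hcoord : ∀ i, ContinuousOn (fun t => c t i) (Icc t₀ t₁) := fun i =>
    (EuclideanSpace.proj (𝕜 := ℝ) i).continuous.comp_continuousOn hcc
  have hhc : ContinuousOn h (Icc t₀ t₁) := by
    refine ContinuousOn.div ((((hcoord 0).pow 2).add ((hcoord 1).pow 2)).sub continuousOn_const)
      (ContinuousOn.rpow_const ((continuousOn_const.sub ((hcoord 0).pow 2)).sub ((hcoord 1).pow 2))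
        fun t ht => Or.inl (hpos t ht).ne') fun t ht => ?_
    exact (Real.rpow_pos_of_pos (hpos t ht) _).ne'
  set J : ℝ → ℂ := fun t => z' t * ((starRingEnd ℂ) (z t) * ((-h t : ℝ) : ℂ)) with hJ
  have hJi : IntervalIntegrable J volume t₀ t₁ := by
    refine hz'i.mul_continuousOn ?_
    rw [uIcc_of_le hab]
    exact (Complex.continuous_conj.comp_continuousOn hzc).mul
      (Complex.continuous_ofReal.comp_continuousOn hhc.neg)
  have hJim : ∀ t ∈ Ioo t₀ t₁ \ S, (J t).im =
      h t * (c t 1 * deriv (fun s => c s 0) t - c t 0 * deriv (fun s => c s 1) t) := by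
    intro t ht
    rw [deriv_coord (hK t ht).1, deriv_coord (hK t ht).1]
    simp only [hJ, hz, hz', planeToComplex_apply]
    simp
    ring
  rw [intervalIntegrable_iff_integrableOn_Ioc_of_le hab] at hJi
  have hJae : ∀ᵐ t, t ∈ Ioo t₀ t₁ → (J t).im =
      h t * (c t 1 * deriv (fun s => c s 0) t - c t 0 * deriv (fun s => c s 1) t) := by
    filter_upwards [hS.ae_notMem volume] with t htS ht using hJim t ⟨ht, htS⟩
  have hline : IntegrableOn (fun t => h t *
      (c t 1 * deriv (fun s => c s 0) t - c t 0 * deriv (fun s => c s 1) t)) (Ioc t₀ t₁) := by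
    have h1 : IntegrableOn (fun t => (J t).im) (Ioc t₀ t₁) := Integrable.im hJi
    rw [integrableOn_Ioc_iff_integrableOn_Ioo] at h1 ⊢
    exact h1.congr ((ae_restrict_iff' measurableSet_Ioo).2 hJae)
  refine ⟨hΩR.trans (Metric.ball_subset_ball hR1.le), hσi,
    (intervalIntegrable_iff_integrableOn_Ioc_of_le hab).2 hline, ?_⟩
  have hinner : ∀ t ∈ Icc t₀ t₁, z' t * ((∫ r in (0 : ℝ)..‖z t‖, r * berwaldRadialDensity r : ℝ) *
      (2 * Real.pi / z t)) = (Real.pi / 4 : ℝ) * J t := by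
    intro t ht
    rw [integral_mul_berwaldRadialDensity (norm_nonneg _) ((hzn t).trans_lt ((hR t ht).trans hR1))]
    have h1 : (‖z t‖ ^ 2 - 4) / (1 - ‖z t‖ ^ 2) ^ (5 / 2 : ℝ) = h t := by
      rw [hzn, hnsq]
      simp only [hh, sub_sub]
    rw [h1]
    simp only [hJ]
    rcases eq_or_ne (z t) 0 with h0 | h0
    · simp [h0]
    · have h2 : ((‖z t‖ : ℂ)) ^ 2 = (starRingEnd ℂ) (z t) * z t := by
        rw [← Complex.normSq_eq_conj_mul_self, Complex.normSq_eq_norm_sq]; push_cast; rfl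
      push_cast
      rw [h2]
      field_simp
      ring
  have hsub : ∫ t in t₀..t₁, z' t * ((∫ r in (0 : ℝ)..‖z t‖, r * berwaldRadialDensity r : ℝ) *
      (2 * Real.pi / z t)) = (Real.pi / 4 : ℝ) * ∫ t in t₀..t₁, J t := by
    rw [← intervalIntegral.integral_const_mul]
    refine intervalIntegral.integral_congr fun t ht => hinner t ?_
    rwa [uIcc_of_le hab] at ht
  have hJint : (∫ t in t₀..t₁, J t).im = ∫ t in t₀..t₁, h t *
      (c t 1 * deriv (fun s => c s 0) t - c t 0 * deriv (fun s => c s 1) t) := by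
    have him := integral_im (𝕜 := ℂ) hJi
    simp only [RCLike.im_to_complex] at him
    rw [intervalIntegral.integral_of_le hab, intervalIntegral.integral_of_le hab, ← him,
      integral_Ioc_eq_integral_Ioo, integral_Ioc_eq_integral_Ioo]
    exact setIntegral_congr_ae measurableSet_Ioo hJae
  rw [holmesThompsonVolume, setIntegral_congr_fun hΩm fun x hx => hσ x (hΩR hx),
    integral_enclosedRegion_radial hc hor hR hgm fun r h0 h1 => hC r ⟨h0, h1.le⟩, hsub, Complex.im_ofReal_mul, hJint]
  change _ = 1 / 8 * ∫ t in t₀..t₁, h t *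
    (c t 1 * deriv (fun s => c s 0) t - c t 0 * deriv (fun s => c s 1) t)
  have := Real.pi_pos
  field_simp
  ring
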